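/- There are an absolute constant $K$ and, for every integer $D\ge 1$, a real matrix $B=B^{(D)}=(B_{\pi,\sigma})_{\pi,\sigma\in S_8}$, depending only on $D$, with $|B_{\pi,\sigma}|\le K D^{-9}$ for all $\pi,\sigma$ (that is, all components of $B$ are $O(D^{-9})$), such that the following holds. Let $A$ be a non-degenerate observable (a Hermitian operator with $D$ distinct eigenvalues) on $\mathbb{C}^D$ with orthonormal eigenbasis $|1\rangle,\dots,|D\rangle$. Let $|x\rangle$ and $|k\rangle$ be two of these eigenvectors (possibly equal), $E_1,\dots,E_D\in\mathbb{R}$ and $t\in\mathbb{R}$. For a unitary $C\in\mathbb{U}(D)$ put $H=C\,\mathrm{diag}(E_1,\dots,E_D)\,C^\dagger$, $U(t)=e^{-itH}$, $\rho(t)=U(t)|x\rangle\langle x|U(t)^\dagger$ and $\Pr(k|\rho(t))=\mathrm{Tr}\big(|k\rangle\langle k|\,\rho(t)\big)$. (For $H$ drawn from the GUE, the $E_a$ are the eigenvalues of $H$, and $C$ is Haar distributed and independent of them.) Let $$|R_8(t)\rangle=\sum_{b_1,\dots,b_8=1}^{D} e^{it(E_{b_1}-E_{b_2}+E_{b_3}-E_{b_4}+E_{b_5}-E_{b_6}+E_{b_7}-E_{b_8})}\,|b_1,\dots,b_8,b_1,\dots,b_8\rangle\in(\mathbb{C}^D)^{\otimes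 16},$$ $$|\Phi_\pi\rangle=(V_\pi\otimes 1)\,|\phi\rangle_{1,9}|\phi\rangle_{2,10}\cdots|\phi\rangle_{8,16},\qquad |\phi\rangle_{i,j}=\sum_{a=1}^D|a\rangle_i|a\rangle_j\qquad(\pi\in S_8),$$ where $V_\pi$ permutes the first eight tensor factors according to $\pi$. Then the fourth moment of the outcome probability, with $C$ distributed according to the Haar probability measure on $\mathbb{U}(D)$ and $E_1,\dots,E_D$ fixed, satisfies $$\mathbb{E}_C\big[\Pr(k|\rho(t))^4\big]\;\le\;\frac{1}{D^8}\sum_{\pi\in S_8}\langle\Phi_\pi|R_8(t)\rangle+\sum_{\pi,\sigma\in S_8}B_{\pi,\sigma}\,\langle\Phi_\sigma|R_8(t)\rangle ,$$ where the right-hand side is a real number. -/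

import Mathlib

open scoped Matrix Kronecker

namespace FourthMoment

section HaarMeasure

variable (D : ℕ)

/-- The unitary group `U(D)` carries its Borel sigma-algebra. -/
noncomputable instance instMeasurableSpaceU : MeasurableSpace (Matrix.unitaryGroup (Fin D) ℂ) := borel _

instance instBorelSpaceU : BorelSpace (Matrix.unitaryGroup (Fin D) ℂ) := ⟨rfl⟩

instance instCompactSpaceU : CompactSpace (Matrix.unitaryGroup (Fin D) ℂ) := by
  refine isCompact_iff_compactSpace.mp (?_ : IsCompact
    ((Matrix.unitaryGroup (Fin D) ℂ : Submonoid (Matrix (Fin D) (Fin D) ℂ)) :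
      Set (Matrix (Fin D) (Fin D) ℂ)))
  have hK : IsCompact (Set.univ.pi fun _ : Fin D =>
      Set.univ.pi fun _ : Fin D => Metric.closedBall (0 : ℂ) 1) :=
    isCompact_univ_pi fun _ => isCompact_univ_pi fun _ => isCompact_closedBall _ _
  refine hK.of_isClosed_subset ?_ ?_
  · have hset : ((Matrix.unitaryGroup (Fin D) ℂ : Submonoid (Matrix (Fin D) (Fin D) ℂ)) :
        Set (Matrix (Fin D) (Fin D) ℂ)) =
        {U | star U * U = 1} ∩ {U | U * star U = 1} := by
      ext U
      simp [Matrix.unitaryGroup, Unitary.mem_iff]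
    have hcl : IsClosed ({U : Matrix (Fin D) (Fin D) ℂ | star U * U = 1} ∩
        {U | U * star U = 1}) :=
      (isClosed_eq (by fun_prop) continuous_const).inter
        (isClosed_eq (by fun_prop) continuous_const)
    rw [← hset] at hcl
    exact hcl
  · intro U hU i _ j _
    simpa using entry_norm_bound_of_unitary hU i j

/-- The Haar probability measure on `U(D)`. -/
noncomputable def haarU : MeasureTheory.Measure (Matrix.unitaryGroup (Fin D) ℂ) :=
  MeasureTheory.Measure.haarMeasure ⊤

end HaarMeasure

/-- The Hamiltonian `H = C diag(E₁, …, E_D) C†`, with eigenvalues `E` and with the columns of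
the unitary `C` as its eigenvectors. -/
noncomputable def hamiltonian {D : ℕ} (E : Fin D → ℝ) (C : Matrix.unitaryGroup (Fin D) ℂ) :
    Matrix (Fin D) (Fin D) ℂ :=
  (C : Matrix (Fin D) (Fin D) ℂ) * Matrix.diagonal (fun a => (E a : ℂ)) *
    (C : Matrix (Fin D) (Fin D) ℂ)ᴴ

/-- The time evolution `U(t) = exp(-i t H)`. -/
noncomputable def evolution {D : ℕ} (H : Matrix (Fin D) (Fin D) ℂ) (t : ℝ) :
    Matrix (Fin D) (Fin D) ℂ :=
  NormedSpace.exp ((-(Complex.I * (t : ℂ))) • H)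

/-- The rank-one operator `|v⟩⟨v|`. -/
def ketbra {D : ℕ} (v : EuclideanSpace ℂ (Fin D)) : Matrix (Fin D) (Fin D) ℂ :=
  Matrix.vecMulVec (fun i => v i) (fun j => star (v j))

/-- The probability `Tr(|k⟩⟨k| ρ(t))` of the outcome belonging to the vector `k`, where
`ρ(t) = U(t) |x⟩⟨x| U(t)†` and `U(t) = exp(-i t H)`. The trace is real. -/
noncomputable def outcomeProb {D : ℕ} (k x : EuclideanSpace ℂ (Fin D))
    (H : Matrix (Fin D) (Fin D) ℂ) (t : ℝ) : ℝ :=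
  (Matrix.trace (ketbra k * evolution H t * ketbra x * (evolution H t)ᴴ)).re

/-- Labels of the product basis of `(ℂ^D)^{⊗8}`. -/
abbrev Idx (D : ℕ) : Type := Fin 8 → Fin D

/-- The operator `V_π` on `(ℂ^D)^{⊗8}` that permutes the tensor factors: the factor in
position `m` moves to position `π m`. -/
def permOp (D : ℕ) (π : Equiv.Perm (Fin 8)) : Matrix (Idx D) (Idx D) ℂ :=
  Matrix.of fun i j => if i = j ∘ π.symm then 1 else 0

/-- The vector `|φ⟩ = ∑ₐ |a⟩|a⟩` of `ℂ^D ⊗ ℂ^D`. -/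
def phi (D : ℕ) : Fin D × Fin D → ℂ := ∑ a : Fin D, Pi.single (a, a) 1

/-- The vector `|Φ_π⟩ = (V_π ⊗ 1) |φ⟩_{1,9} |φ⟩_{2,10} ⋯ |φ⟩_{8,16}` of `(ℂ^D)^{⊗16}`, whose
product basis is labelled by the pairs (first eight labels, last eight labels). -/
def Phi (D : ℕ) (π : Equiv.Perm (Fin 8)) : Idx D × Idx D → ℂ :=
  (permOp D π ⊗ₖ (1 : Matrix (Idx D) (Idx D) ℂ)) *ᵥ
    fun p => ∏ m : Fin 8, phi D (p.1 m, p.2 m)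

/-- The vector `|R₈(t)⟩ = ∑_b exp(i t (E_{b₁} - E_{b₂} + ⋯ + E_{b₇} - E_{b₈})) |b, b⟩`. -/
noncomputable def R8 {D : ℕ} (E : Fin D → ℝ) (t : ℝ) : Idx D × Idx D → ℂ :=
  ∑ b : Idx D,
    Complex.exp (Complex.I * (t : ℂ) * ∑ m : Fin 8, (-1 : ℂ) ^ (m : ℕ) * (E (b m) : ℂ)) •
      (Pi.single (b, b) 1 : Idx D × Idx D → ℂ)

/-- The inner product `⟨Φ_π | R₈(t)⟩`. -/
noncomputable def overlap {D : ℕ} (E : Fin D → ℝ) (t : ℝ) (π : Equiv.Perm (Fin 8)) : ℂ :=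
  star (Phi D π) ⬝ᵥ R8 E t

end FourthMoment

/-!
Write `u_a = exp (i t E_a)`. The overlap of `Φ_π` with `R₈` is the sum of the phases of the words
`b` that `π` fixes, so the sum over all `π` is `∑ b, phase b * ∏ a, (occurrences b a)!`
(`sum_overlap`). By invariance of the Haar measure the eigenbasis of `A` may be taken to be the
standard basis, and the integrand is `|(C diag(ū) C†) k x| ^ 8`.

The Weingarten calculus is replaced by a relation between the moments of a unitarily invariant
random vector `Y`: rotating two coordinates and differentiating at angle zero gives
`(β_b + 1) E[y^β y_a] = (β_a + 1) E[y^β y_b]` with `y_a = |Y_a|²` (`UnitarilyInvariantOn.exchange`).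
Summed over `b` it determines the moments of a uniformly distributed unit vector
(`UnitarilyInvariantOn.integral_prod_normSq`) and bounds those of a subnormalized invariant vector
(`UnitarilyInvariantOn.integral_normSq_pow_le`).

* For `k = x`, applied to the row `k` of `C`, it shows that the integral is the sum of all overlaps
  divided by `D (D + 1) ⋯ (D + 7) ≥ D ^ 8`. In particular the sum is real and nonnegative.
* For `k ≠ x`, applied to the off-diagonal part of the row `k` of the evolution operator, which is
  invariant under the unitaries of the orthogonal complement of the `k`-th basis vector, it bounds
  the integral by `24 / D ^ 4`.

It remains to compare `24 * D ^ 4` with the sum of the overlaps. The Vandermonde identity writes the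
kernel `∏ a, (α_a + β_a)!` as a sum of squares, and the squares belonging to sets of four distinct
letters already contribute `24 D (D - 1) (D - 2) (D - 3)`, which is at least `24 D ^ 4 - 144 D ^ 3`
(`le_re_sum_overlap`). The deficit `144 D ^ 3` is supplied by the correction term: the overlap of a
permutation that pairs even with odd positions is at least `D ^ 4`, and weight `144 / D ^ 9` on it
suffices.
-/

open scoped Matrix Kronecker

namespace FourthMoment

open MeasureTheory

/-! ### Unitarily invariant random vectors -/

section UnitaryInvariance

variable {Ω : Type*} [TopologicalSpace Ω] [CompactSpace Ω] [MeasurableSpace Ω] [BorelSpace Ω]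
  {μ : Measure Ω} [IsFiniteMeasure μ]

lemma integrable_of_continuous {E : Type*} [NormedAddCommGroup E] [SecondCountableTopology E]
    {f : Ω → E} (hf : Continuous f) : Integrable f μ := by
  obtain ⟨M, hM⟩ := isCompact_univ.exists_bound_of_continuousOn hf.continuousOn
  exact Integrable.of_bound hf.aestronglyMeasurable M (.of_forall fun ω => hM ω trivial)

/-- Differentiation under the integral sign over a compact space: if `θ ↦ ∫ F θ` is constant,
its derivative at `0` vanishes. -/
lemma integral_deriv_eq_zero {F F' : ℝ → Ω → ℂ} (hF : ∀ θ, Continuous (F θ))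
    (hF' : Continuous (Function.uncurry F'))
    (hd : ∀ ω θ, HasDerivAt (fun θ => F θ ω) (F' θ ω) θ)
    (hconst : ∀ θ, ∫ ω, F θ ω ∂μ = ∫ ω, F 0 ω ∂μ) : ∫ ω, F' 0 ω ∂μ = 0 := by
  have hK : IsCompact (Metric.closedBall (0 : ℝ) 1 ×ˢ (Set.univ : Set Ω)) :=
    (isCompact_closedBall _ _).prod isCompact_univ
  obtain ⟨M, hM⟩ := hK.exists_bound_of_continuousOn hF'.continuousOn
  have h := (hasDerivAt_integral_of_dominated_loc_of_deriv_le (μ := μ) (F := F) (F' := F')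
    (x₀ := (0 : ℝ)) (s := Metric.closedBall 0 1) (bound := fun _ => M)
    (Metric.closedBall_mem_nhds _ one_pos)
    (.of_forall fun θ => (hF θ).aestronglyMeasurable)
    (integrable_of_continuous (hF 0))
    ((hF'.comp (Continuous.prodMk_right (0 : ℝ))).aestronglyMeasurable)
    (.of_forall fun ω θ hθ => hM (θ, ω) ⟨hθ, trivial⟩)
    (integrable_const M) (.of_forall fun ω θ _ => hd ω θ)).2
  rw [funext hconst] at h
  exact h.unique (hasDerivAt_const _ _)

variable {ι : Type*} [DecidableEq ι]

/-- The rotation by the angle `θ` in the plane of the coordinates `a` and `b`. -/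
noncomputable def planeRotation (a b : ι) (θ : ℝ) : Matrix ι ι ℂ :=
  1 + ((Real.cos θ : ℂ) - 1) • (Matrix.single a a 1 + Matrix.single b b 1) +
    (Real.sin θ : ℂ) • (Matrix.single b a 1 - Matrix.single a b 1)

lemma planeRotation_apply_of_notMem {S : Finset ι} {a b : ι} (ha : a ∈ S) (hb : b ∈ S) (θ : ℝ)
    (i : ι) (hi : i ∉ S) (j : ι) :
    planeRotation a b θ i j = (1 : Matrix ι ι ℂ) i j ∧
      planeRotation a b θ j i = (1 : Matrix ι ι ℂ) j i := by
  have hai : a ≠ i := fun h => hi (h ▸ ha)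
  have hbi : b ≠ i := fun h => hi (h ▸ hb)
  simp [planeRotation, hai, hbi]

/-- The unitary matrix that multiplies the coordinate `a` by the phase `I`. -/
noncomputable def coordPhase (a : ι) : Matrix ι ι ℂ :=
  Matrix.diagonal (Function.update 1 a Complex.I)

lemma coordPhase_apply_of_notMem {S : Finset ι} {a : ι} (ha : a ∈ S)
    (i : ι) (hi : i ∉ S) (j : ι) :
    coordPhase a i j = (1 : Matrix ι ι ℂ) i j ∧ coordPhase a j i = (1 : Matrix ι ι ℂ) j i := by
  have hai : i ≠ a := fun h => hi (h ▸ ha)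
  constructor
  · by_cases h : i = j
    · subst h; simp [coordPhase, hai]
    · simp [coordPhase, h]
  · by_cases h : j = i
    · subst h; simp [coordPhase, hai]
    · simp [coordPhase, h]

variable [Fintype ι]

/-- The law of the random row vector `Y` is invariant under right multiplication by the unitary
matrices that act only on the coordinates in `S`. Invariance is tested on continuous functions. -/
def UnitarilyInvariantOn (μ : Measure Ω) (Y : Ω → ι → ℂ) (S : Finset ι) : Prop :=
  ∀ R ∈ Matrix.unitaryGroup ι ℂ,
    (∀ i, i ∉ S → ∀ j, R i j = (1 : Matrix ι ι ℂ) i j ∧ R j i = (1 : Matrix ι ι ℂ) j i) →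
    ∀ g : (ι → ℂ) → ℂ, Continuous g → ∫ ω, g (Y ω ᵥ* R) ∂μ = ∫ ω, g (Y ω) ∂μ

lemma planeRotation_mem_unitaryGroup {a b : ι} (hab : a ≠ b) (θ : ℝ) :
    planeRotation a b θ ∈ Matrix.unitaryGroup ι ℂ := by
  rw [Matrix.mem_unitaryGroup_iff]
  set P : Matrix ι ι ℂ := Matrix.single a a 1 + Matrix.single b b 1 with hP
  set J : Matrix ι ι ℂ := Matrix.single b a 1 - Matrix.single a b 1 with hJ
  have hPP : P * P = P := by simp [hP, mul_add, add_mul, hab, hab.symm]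
  have hPJ : P * J = J := by simp [hP, hJ, mul_sub, add_mul, hab, hab.symm]
  have hJP : J * P = J := by simp [hP, hJ, mul_add, sub_mul, hab, hab.symm]; abel
  have hJJ : J * J = -P := by simp [hP, hJ, mul_sub, sub_mul, hab, hab.symm]; abel
  have hPs : star P = P := by simp [hP, Matrix.star_eq_conjTranspose]
  have hJs : star J = -J := by simp [hJ, Matrix.star_eq_conjTranspose]
  have hcs : (Real.cos θ : ℂ) ^ 2 + (Real.sin θ : ℂ) ^ 2 = 1 := by
    exact_mod_cast Real.cos_sq_add_sin_sq θ
  have hR : planeRotation a b θ = 1 + ((Real.cos θ : ℂ) - 1) • P + (Real.sin θ : ℂ) • J := rfl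
  have hRs : star (planeRotation a b θ) =
      1 + ((Real.cos θ : ℂ) - 1) • P - (Real.sin θ : ℂ) • J := by
    rw [hR]
    simp [hPs, hJs, sub_eq_add_neg, -Complex.ofReal_cos, -Complex.ofReal_sin]
  rw [hRs, hR]
  generalize (Real.cos θ : ℂ) = c at *
  generalize (Real.sin θ : ℂ) = s at *
  have : (1 + (c - 1) • P + s • J) * (1 + (c - 1) • P - s • J)
      = 1 + (c ^ 2 + s ^ 2 - 1) • P := by
    simp only [mul_add, add_mul, mul_sub, smul_mul_assoc, mul_smul_comm, hPP, hPJ, hJP, hJJ,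
      one_mul, mul_one]
    module
  rw [this, hcs]
  simp

lemma vecMul_planeRotation {a b : ι} (hab : a ≠ b) (θ : ℝ) (v : ι → ℂ) (i : ι) :
    (v ᵥ* planeRotation a b θ) i =
      if i = a then Real.cos θ * v a + Real.sin θ * v b
      else if i = b then -(Real.sin θ * v a) + Real.cos θ * v b else v i := by
  have h1 : ∀ c d : ι, (v ᵥ* Matrix.single c d (1 : ℂ)) i = if i = d then v c else 0 := by
    intro c d
    simp [Matrix.vecMul, dotProduct, Matrix.single_apply, eq_comm, ite_and]
  simp only [planeRotation, Matrix.vecMul_add, Matrix.vecMul_smul, Matrix.vecMul_sub,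
    Matrix.vecMul_one, Pi.add_apply, Pi.smul_apply, Pi.sub_apply, h1, smul_eq_mul]
  by_cases hia : i = a
  · subst hia; simp [hab]; ring
  · by_cases hib : i = b
    · subst hib; simp [hia]; ring
    · simp [hia, hib]

lemma coordPhase_mem_unitaryGroup (a : ι) : coordPhase a ∈ Matrix.unitaryGroup ι ℂ := by
  rw [Matrix.mem_unitaryGroup_iff, coordPhase, Matrix.star_eq_conjTranspose,
    Matrix.diagonal_conjTranspose, Matrix.diagonal_mul_diagonal, ← Matrix.diagonal_one]
  congr 1
  ext i
  by_cases h : i = a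
  · subst h; simp
  · simp [h]

lemma vecMul_coordPhase (a : ι) (v : ι → ℂ) :
    v ᵥ* coordPhase a = Function.update v a (Complex.I * v a) := by
  ext i
  rw [coordPhase, Matrix.vecMul_diagonal]
  by_cases h : i = a
  · subst h; simp [mul_comm]
  · simp [h]

end UnitaryInvariance

section Exchange

variable {Ω : Type*} [MeasurableSpace Ω] {μ : Measure Ω} {ι : Type*} [DecidableEq ι] [Fintype ι]

/-- The phase `I` on the coordinate `a` leaves the integral unchanged and changes the sign of `g`. The
monomials whose degrees in `v a` and in `conj (v a)` differ by two have this property. -/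
lemma UnitarilyInvariantOn.integral_eq_zero {Y : Ω → ι → ℂ} {S : Finset ι}
    (h : UnitarilyInvariantOn μ Y S) {a : ι} (ha : a ∈ S) {g : (ι → ℂ) → ℂ} (hg : Continuous g)
    (hphase : ∀ v, g (Function.update v a (Complex.I * v a)) = -g v) :
    ∫ ω, g (Y ω) ∂μ = 0 := by
  have := h _ (coordPhase_mem_unitaryGroup a) (coordPhase_apply_of_notMem ha) g hg
  simp only [vecMul_coordPhase, hphase, integral_neg] at this
  exact self_eq_neg.mp this.symm

variable [TopologicalSpace Ω] [CompactSpace Ω] [BorelSpace Ω] [IsFiniteMeasure μ]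

/-- Compares multiplying a monomial by `|Y_a|²` and by `|Y_b|²`. The rotations in the `(a, b)`-plane leave
`∫ g (Y)` unchanged for `g = v_a ^ (p + 1) * v_b ^ q * conj v_a ^ p * conj v_b ^ (q + 1) * ρ`;
their generator at angle zero gives a linear relation between four integrals, two of which vanish
by invariance under phases. -/
lemma UnitarilyInvariantOn.exchange_monomial {Y : Ω → ι → ℂ} (hY : Continuous Y) {S : Finset ι}
    (h : UnitarilyInvariantOn μ Y S) {a b : ι} (hab : a ≠ b) (ha : a ∈ S) (hb : b ∈ S)
    (p q : ℕ) (ρ : (ι → ℂ) → ℂ) (hρ : Continuous ρ)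
    (hρab : ∀ v w : ι → ℂ, (∀ i, i ≠ a → i ≠ b → v i = w i) → ρ v = ρ w) :
    (q + 1 : ℂ) * ∫ ω, (Y ω a * star (Y ω a)) ^ (p + 1) * (Y ω b * star (Y ω b)) ^ q * ρ (Y ω) ∂μ =
    (p + 1 : ℂ) *
      ∫ ω, (Y ω a * star (Y ω a)) ^ p * (Y ω b * star (Y ω b)) ^ (q + 1) * ρ (Y ω) ∂μ := by
  have hYi : ∀ i, Continuous fun ω => Y ω i := fun i => (continuous_apply i).comp hY
  have hρY : Continuous fun ω => ρ (Y ω) := hρ.comp hY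
  -- the rotated coordinates, as functions of the angle
  let A : ℝ → ℂ → ℂ → ℂ := fun θ x y => Real.cos θ * x + Real.sin θ * y
  let B : ℝ → ℂ → ℂ → ℂ := fun θ x y => -(Real.sin θ * x) + Real.cos θ * y
  have hA : ∀ x y θ, HasDerivAt (fun θ => A θ x y) (B θ x y) θ := by
    intro x y θ
    have h1 := ((Real.hasDerivAt_cos θ).ofReal_comp.mul_const x).add
      ((Real.hasDerivAt_sin θ).ofReal_comp.mul_const y)
    refine h1.congr_deriv ?_
    simp [B]
  have hB : ∀ x y θ, HasDerivAt (fun θ => B θ x y) (-A θ x y) θ := by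
    intro x y θ
    have h1 := ((Real.hasDerivAt_sin θ).ofReal_comp.mul_const x).neg.add
      ((Real.hasDerivAt_cos θ).ofReal_comp.mul_const y)
    refine h1.congr_deriv ?_
    simp [A]; ring
  have hrot : ∀ θ, ∫ ω, (A θ (Y ω a) (Y ω b)) ^ (p + 1) * (B θ (Y ω a) (Y ω b)) ^ q *
      ((A θ (star (Y ω a)) (star (Y ω b))) ^ p *
        (B θ (star (Y ω a)) (star (Y ω b))) ^ (q + 1)) * ρ (Y ω) ∂μ =
      ∫ ω, Y ω a ^ (p + 1) * Y ω b ^ q * (star (Y ω a) ^ p * star (Y ω b) ^ (q + 1)) *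
        ρ (Y ω) ∂μ := by
    intro θ
    rw [← h _ (planeRotation_mem_unitaryGroup hab θ) (planeRotation_apply_of_notMem ha hb θ)
      (fun v => v a ^ (p + 1) * v b ^ q * (star (v a) ^ p * star (v b) ^ (q + 1)) * ρ v)
      (by fun_prop)]
    refine integral_congr_ae (.of_forall fun ω => ?_)
    have hρ' : ρ (Y ω ᵥ* planeRotation a b θ) = ρ (Y ω) := by
      apply hρab
      intro i hia hib
      rw [vecMul_planeRotation hab, if_neg hia, if_neg hib]
    simp only [hρ', vecMul_planeRotation hab, if_true, if_neg hab.symm, A, B]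
    simp [-Complex.ofReal_cos, -Complex.ofReal_sin]
  have hzero := integral_deriv_eq_zero (μ := μ)
    (F := fun θ ω => (A θ (Y ω a) (Y ω b)) ^ (p + 1) * (B θ (Y ω a) (Y ω b)) ^ q *
      ((A θ (star (Y ω a)) (star (Y ω b))) ^ p *
        (B θ (star (Y ω a)) (star (Y ω b))) ^ (q + 1)) * ρ (Y ω))
    (F' := fun θ ω =>
      ((((p + 1 : ℕ) * A θ (Y ω a) (Y ω b) ^ p * B θ (Y ω a) (Y ω b)) *
          B θ (Y ω a) (Y ω b) ^ q +
        A θ (Y ω a) (Y ω b) ^ (p + 1) *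
          (q * B θ (Y ω a) (Y ω b) ^ (q - 1) * -A θ (Y ω a) (Y ω b))) *
      (A θ (star (Y ω a)) (star (Y ω b)) ^ p * B θ (star (Y ω a)) (star (Y ω b)) ^ (q + 1)) +
      (A θ (Y ω a) (Y ω b)) ^ (p + 1) * (B θ (Y ω a) (Y ω b)) ^ q *
      ((p * A θ (star (Y ω a)) (star (Y ω b)) ^ (p - 1) * B θ (star (Y ω a)) (star (Y ω b))) *
          B θ (star (Y ω a)) (star (Y ω b)) ^ (q + 1) +
        A θ (star (Y ω a)) (star (Y ω b)) ^ p *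
          ((q + 1 : ℕ) * B θ (star (Y ω a)) (star (Y ω b)) ^ q *
            -A θ (star (Y ω a)) (star (Y ω b))))) * ρ (Y ω))
    (by intro θ; simp only [A, B]; fun_prop)
    (by simp only [A, B, Function.uncurry_def]; fun_prop)
    (by
      intro ω θ
      exact (((hA _ _ θ).pow (p + 1)).mul ((hB _ _ θ).pow q)).mul
        (((hA _ _ θ).pow p).mul ((hB _ _ θ).pow (q + 1))) |>.mul_const _)
    (by intro θ; rw [hrot, hrot])
  simp only [A, B, Real.cos_zero, Real.sin_zero, Complex.ofReal_one, Complex.ofReal_zero, one_mul,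
    zero_mul, add_zero, neg_zero, zero_add] at hzero
  -- the two cross terms carry the phase `I ^ 2` under `v_a ↦ I * v_a`
  have hc1 : ∫ ω, Y ω a ^ (p + 2) * Y ω b ^ (q - 1) * (star (Y ω a) ^ p * star (Y ω b) ^ (q + 1)) *
      ρ (Y ω) ∂μ = 0 := by
    refine h.integral_eq_zero ha (g := fun v => v a ^ (p + 2) * v b ^ (q - 1) *
      (star (v a) ^ p * star (v b) ^ (q + 1)) * ρ v) (by fun_prop) fun v => ?_
    have hρ' : ρ (Function.update v a (Complex.I * v a)) = ρ v :=
      hρab _ _ fun i hia _ => by simp [hia]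
    have hI : Complex.I ^ p * (-Complex.I) ^ p = 1 := by rw [← mul_pow]; simp
    simp only [hρ', Function.update_self, Function.update_of_ne hab.symm, mul_pow, star_mul',
      pow_add Complex.I, Complex.I_sq]
    simp only [Complex.star_def, Complex.conj_I]
    linear_combination (-(v a ^ (p + 2) * v b ^ (q - 1) *
      ((starRingEnd ℂ) (v a) ^ p * (starRingEnd ℂ) (v b) ^ (q + 1)) * ρ v)) * hI
  have hc2 : (p : ℂ) * ∫ ω, Y ω a ^ (p + 1) * Y ω b ^ q *
      (star (Y ω a) ^ (p - 1) * star (Y ω b) ^ (q + 2)) * ρ (Y ω) ∂μ = 0 := by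
    rcases p with _ | p
    · simp
    rw [mul_eq_zero]; right
    refine h.integral_eq_zero ha (g := fun v => v a ^ (p + 2) * v b ^ q *
      (star (v a) ^ p * star (v b) ^ (q + 2)) * ρ v) (by fun_prop) fun v => ?_
    have hρ' : ρ (Function.update v a (Complex.I * v a)) = ρ v :=
      hρab _ _ fun i hia _ => by simp [hia]
    have hI : Complex.I ^ p * (-Complex.I) ^ p = 1 := by rw [← mul_pow]; simp
    simp only [hρ', Function.update_self, Function.update_of_ne hab.symm, mul_pow, star_mul',
      pow_add Complex.I, Complex.I_sq]
    simp only [Complex.star_def, Complex.conj_I]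
    linear_combination (-(v a ^ (p + 2) * v b ^ q *
      ((starRingEnd ℂ) (v a) ^ p * (starRingEnd ℂ) (v b) ^ (q + 2)) * ρ v)) * hI
  have hint : ∀ {f : Ω → ℂ}, Continuous f → Integrable f μ := integrable_of_continuous
  have hsplit : ∫ ω, ((p + 1 : ℂ) *
        ((Y ω a * star (Y ω a)) ^ p * (Y ω b * star (Y ω b)) ^ (q + 1) * ρ (Y ω)) -
      (q : ℂ) * (Y ω a ^ (p + 2) * Y ω b ^ (q - 1) * (star (Y ω a) ^ p * star (Y ω b) ^ (q + 1)) *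
        ρ (Y ω)) +
      (p : ℂ) * (Y ω a ^ (p + 1) * Y ω b ^ q *
        (star (Y ω a) ^ (p - 1) * star (Y ω b) ^ (q + 2)) * ρ (Y ω)) -
      (q + 1 : ℂ) *
        ((Y ω a * star (Y ω a)) ^ (p + 1) * (Y ω b * star (Y ω b)) ^ q * ρ (Y ω))) ∂μ = 0 := by
    rw [← hzero]
    refine integral_congr_ae (.of_forall fun ω => ?_)
    simp only
    push_cast
    ring
  rw [integral_sub (hint (by fun_prop)) (hint (by fun_prop)),
    integral_add (hint (by fun_prop)) (hint (by fun_prop)),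
    integral_sub (hint (by fun_prop)) (hint (by fun_prop))] at hsplit
  simp only [integral_const_mul] at hsplit
  rw [hc1, hc2] at hsplit
  linear_combination -hsplit

end Exchange

/-! ### Moments of the squared moduli of the coordinates -/

/-- The number of times that the value `a` occurs in the word `b`. -/
def occurrences {n : ℕ} {ι : Type*} [DecidableEq ι] (b : Fin n → ι) (a : ι) : ℕ :=
  Fintype.card {m // b m = a}

section Occurrences

variable {n : ℕ} {ι : Type*} [DecidableEq ι]

lemma occurrences_succ (b : Fin (n + 1) → ι) (a : ι) :
    occurrences b a = (if b 0 = a then 1 else 0) + occurrences (fun m => b m.succ) a := by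
  simp only [occurrences, Fintype.card_subtype, Finset.card_filter, Fin.sum_univ_succ]

variable [Fintype ι]

lemma prod_comp_eq_prod_pow_occurrences {M : Type*} [CommMonoid M] (b : Fin n → ι) (y : ι → M) :
    ∏ m, y (b m) = ∏ a, y a ^ occurrences b a := by
  rw [← Finset.prod_fiberwise' Finset.univ b y]
  simp [occurrences, Fintype.card_subtype]

lemma sum_occurrences (b : Fin n → ι) : ∑ a, occurrences b a = n := by
  simp only [occurrences, Fintype.card_subtype]
  rw [← Finset.card_eq_sum_card_fiberwise (by simp)]
  simp

lemma prod_factorial_occurrences_succ (b : Fin (n + 1) → ι) :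
    ∏ a, (occurrences b a).factorial =
      (occurrences (fun m => b m.succ) (b 0) + 1) *
        ∏ a, (occurrences (fun m => b m.succ) a).factorial := by
  rw [← Finset.mul_prod_erase _ _ (Finset.mem_univ (b 0)),
    ← Finset.mul_prod_erase _ (fun a => (occurrences (fun m => b m.succ) a).factorial)
      (Finset.mem_univ (b 0)), ← mul_assoc]
  congr 1
  · rw [occurrences_succ, if_pos rfl, add_comm, Nat.factorial_succ]
  · refine Finset.prod_congr rfl fun a ha => ?_
    rw [occurrences_succ, if_neg (Finset.ne_of_mem_erase ha).symm, zero_add]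

end Occurrences

section Moments

variable {Ω : Type*} [MeasurableSpace Ω] {μ : Measure Ω} {ι : Type*} [DecidableEq ι] [Fintype ι]
  [TopologicalSpace Ω] [CompactSpace Ω] [BorelSpace Ω] [IsFiniteMeasure μ]
  {Y : Ω → ι → ℂ} {S : Finset ι}

lemma UnitarilyInvariantOn.exchange (hY : Continuous Y) (h : UnitarilyInvariantOn μ Y S) {a b : ι}
    (ha : a ∈ S) (hb : b ∈ S) (β : ι → ℕ) :
    (β b + 1 : ℝ) * ∫ ω, (∏ i, Complex.normSq (Y ω i) ^ β i) * Complex.normSq (Y ω a) ∂μ =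
      (β a + 1 : ℝ) * ∫ ω, (∏ i, Complex.normSq (Y ω i) ^ β i) * Complex.normSq (Y ω b) ∂μ := by
  rcases eq_or_ne a b with rfl | hab
  · rfl
  have hsplit : ∀ v : ι → ℂ, ((∏ i, Complex.normSq (v i) ^ β i : ℝ) : ℂ) =
      (v a * star (v a)) ^ β a * (v b * star (v b)) ^ β b *
        ∏ i ∈ (Finset.univ.erase a).erase b, (v i * star (v i)) ^ β i := by
    intro v
    push_cast
    rw [← Finset.mul_prod_erase _ _ (Finset.mem_univ a),
      ← Finset.mul_prod_erase _ _ (Finset.mem_erase.2 ⟨hab.symm, Finset.mem_univ b⟩), ← mul_assoc]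
    simp only [Complex.star_def, Complex.mul_conj]
  have key := h.exchange_monomial hY hab ha hb (β a) (β b)
    (fun v => ∏ i ∈ (Finset.univ.erase a).erase b, (v i * star (v i)) ^ β i) (by fun_prop)
    (fun v w hvw => Finset.prod_congr rfl fun i hi => by
      simp only [Finset.mem_erase] at hi
      rw [hvw i hi.2.1 hi.1])
  have hmul : ∀ x y : ℝ, (((x + 1) * y : ℝ) : ℂ) = ((x : ℂ) + 1) * (y : ℂ) := by
    intro x y; push_cast; ring
  rw [← Complex.ofReal_inj, hmul, hmul, ← integral_complex_ofReal, ← integral_complex_ofReal]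
  refine Eq.trans (congrArg₂ _ rfl (integral_congr_ae (.of_forall fun ω => ?_))) (key.trans
    (congrArg₂ _ rfl (integral_congr_ae (.of_forall fun ω => ?_))))
  all_goals
    simp only [Complex.ofReal_mul, hsplit, ← Complex.mul_conj, ← Complex.star_def]
    ring

/-- Summing `exchange` over `b ∈ S`: multiplying a monomial by `|Y_a|²` is a multiple of
multiplying it by the squared norm of the `S`-part of `Y`. -/
lemma UnitarilyInvariantOn.moment_succ (hY : Continuous Y) (h : UnitarilyInvariantOn μ Y S) {a : ι}
    (ha : a ∈ S) (β : ι → ℕ) :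
    ((∑ i ∈ S, β i + S.card : ℕ) : ℝ) *
        ∫ ω, (∏ i, Complex.normSq (Y ω i) ^ β i) * Complex.normSq (Y ω a) ∂μ =
      (β a + 1 : ℝ) * ∫ ω, (∏ i, Complex.normSq (Y ω i) ^ β i) *
        ∑ b ∈ S, Complex.normSq (Y ω b) ∂μ := by
  have hc : ∀ b, Continuous fun ω => Complex.normSq (Y ω b) := fun b =>
    Complex.continuous_normSq.comp ((continuous_apply b).comp hY)
  simp only [Finset.mul_sum]
  rw [integral_finsetSum _ fun b _ => integrable_of_continuous (by fun_prop), Finset.mul_sum,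
    ← Finset.sum_congr rfl fun b hb => h.exchange hY ha hb β, ← Finset.sum_mul]
  push_cast
  rw [Finset.sum_add_distrib]
  simp

/-- The mixed moments of the squared moduli of a uniformly distributed unit vector. -/
lemma UnitarilyInvariantOn.integral_prod_normSq [IsProbabilityMeasure μ] (hY : Continuous Y)
    (h : UnitarilyInvariantOn μ Y Finset.univ) (hnorm : ∀ ω, ∑ i, Complex.normSq (Y ω i) = 1)
    {n : ℕ} (b : Fin n → ι) :
    ((Fintype.card ι).ascFactorial n : ℝ) * ∫ ω, ∏ m, Complex.normSq (Y ω (b m)) ∂μ =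
      ∏ a, ((occurrences b a).factorial : ℝ) := by
  induction n with
  | zero => simp [occurrences]
  | succ n ih =>
    have h1 := h.moment_succ hY (Finset.mem_univ (b 0)) (occurrences fun m => b m.succ)
    simp only [hnorm, mul_one, sum_occurrences, Finset.card_univ,
      ← prod_comp_eq_prod_pow_occurrences (fun m => b m.succ)] at h1
    have h2 := ih (fun m => b m.succ)
    have h3 : ∏ a, ((occurrences b a).factorial : ℝ) =
      (occurrences (fun m => b m.succ) (b 0) + 1) *
        ∏ a, ((occurrences (fun m => b m.succ) a).factorial : ℝ) := by
      exact_mod_cast prod_factorial_occurrences_succ b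
    rw [h3, ← h2, Nat.ascFactorial_succ]
    simp only [Fin.prod_univ_succ]
    simp only [mul_comm (Complex.normSq (Y _ (b 0)))]
    push_cast at h1 ⊢
    linear_combination ((Fintype.card ι).ascFactorial n : ℝ) * h1

/-- The moments of one coordinate of a subnormalized unitarily invariant vector are at most those
of a coordinate of a uniformly distributed unit vector. -/
lemma UnitarilyInvariantOn.integral_normSq_pow_le [IsProbabilityMeasure μ] (hY : Continuous Y)
    (h : UnitarilyInvariantOn μ Y S) (hnorm : ∀ ω, ∑ i ∈ S, Complex.normSq (Y ω i) ≤ 1)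
    {a : ι} (ha : a ∈ S) (n : ℕ) :
    (S.card.ascFactorial n : ℝ) * ∫ ω, Complex.normSq (Y ω a) ^ n ∂μ ≤ n.factorial := by
  have hc : ∀ b, Continuous fun ω => Complex.normSq (Y ω b) := fun b =>
    Complex.continuous_normSq.comp ((continuous_apply b).comp hY)
  induction n with
  | zero => simp
  | succ n ih =>
    have hprod : ∀ ω, ∏ i, Complex.normSq (Y ω i) ^ (Pi.single a n : ι → ℕ) i =
        Complex.normSq (Y ω a) ^ n := by
      intro ω
      rw [Finset.prod_eq_single a (fun i _ hi => by simp [hi]) (by simp)]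
      simp
    have h1 := h.moment_succ hY ha (Pi.single a n)
    simp only [hprod, ← pow_succ, Pi.single_eq_same, Finset.sum_pi_single', if_pos ha] at h1
    have h2 : ∫ ω, Complex.normSq (Y ω a) ^ n * ∑ b ∈ S, Complex.normSq (Y ω b) ∂μ ≤
        ∫ ω, Complex.normSq (Y ω a) ^ n ∂μ := by
      refine integral_mono (integrable_of_continuous (by fun_prop))
        (integrable_of_continuous (by fun_prop)) fun ω => ?_
      exact mul_le_of_le_one_right (pow_nonneg (Complex.normSq_nonneg _) _) (hnorm ω)
    calc (S.card.ascFactorial (n + 1) : ℝ) * ∫ ω, Complex.normSq (Y ω a) ^ (n + 1) ∂μ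
        = S.card.ascFactorial n *
          ((n + S.card : ℕ) * ∫ ω, Complex.normSq (Y ω a) ^ (n + 1) ∂μ) := by
          rw [Nat.ascFactorial_succ]; push_cast; ring
      _ ≤ S.card.ascFactorial n * ((n + 1) * ∫ ω, Complex.normSq (Y ω a) ^ n ∂μ) := by
          rw [h1]; gcongr
      _ = (n + 1) * (S.card.ascFactorial n * ∫ ω, Complex.normSq (Y ω a) ^ n ∂μ) := by ring
      _ ≤ (n + 1) * n.factorial := by gcongr
      _ = (n + 1).factorial := by rw [Nat.factorial_succ]; push_cast; ring

end Moments

/-! ### The sum of the overlaps -/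

section PermutationSum

/-- The phase `exp (i t E_a)`. -/
noncomputable def energyPhase {D : ℕ} (E : Fin D → ℝ) (t : ℝ) (a : Fin D) : ℂ :=
  Complex.exp (Complex.I * t * E a)

/-- The phase at the position `m` of a word of length eight: `exp (i t E_a)` at the positions
with even index, its conjugate at the others. -/
noncomputable def alternatingPhase {D : ℕ} (E : Fin D → ℝ) (t : ℝ) (m : Fin 8) (a : Fin D) : ℂ :=
  Complex.exp (Complex.I * t * ((-1) ^ (m : ℕ) * E a))

variable {D : ℕ} (E : Fin D → ℝ) (t : ℝ)

lemma star_energyPhase (a : Fin D) :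
    star (energyPhase E t a) = Complex.exp (-(Complex.I * t * E a)) := by
  simp [energyPhase, ← Complex.exp_conj]

lemma energyPhase_mul_star (a : Fin D) : energyPhase E t a * star (energyPhase E t a) = 1 := by
  rw [star_energyPhase, energyPhase, ← Complex.exp_add]
  simp

lemma Phi_apply (π : Equiv.Perm (Fin 8)) (p : Idx D × Idx D) :
    Phi D π p = if p.1 = p.2 ∘ π.symm then 1 else 0 := by
  have hphi : ∀ q : Fin D × Fin D, phi D q = if q.1 = q.2 then 1 else 0 := by
    rintro ⟨i, j⟩
    simp only [phi, Finset.sum_apply, Pi.single_apply, Prod.mk.injEq]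
    by_cases h : i = j
    · subst h; simp
    · rw [if_neg h, Finset.sum_eq_zero]
      rintro a -
      rw [if_neg]
      rintro ⟨rfl, rfl⟩
      exact h rfl
  have hprod : ∀ q : Idx D × Idx D, ∏ m, phi D (q.1 m, q.2 m) = if q.1 = q.2 then 1 else 0 := by
    intro q
    simp only [hphi, Finset.prod_ite_zero, Finset.prod_const_one, Finset.mem_univ, true_imp_iff,
      funext_iff]
  obtain ⟨i, j⟩ := p
  simp only [Phi, Matrix.mulVec, dotProduct, hprod, Fintype.sum_prod_type,
    Matrix.kroneckerMap_apply, permOp, Matrix.of_apply, Matrix.one_apply]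
  simp

lemma overlap_eq_sum (π : Equiv.Perm (Fin 8)) :
    overlap E t π = ∑ b : Idx D,
      if b ∘ π.symm = b then ∏ m, alternatingPhase E t m (b m) else 0 := by
  have hphase : ∀ b : Idx D, ∏ m, alternatingPhase E t m (b m) =
      Complex.exp (Complex.I * t * ∑ m : Fin 8, (-1) ^ (m : ℕ) * (E (b m) : ℂ)) := by
    intro b
    simp only [alternatingPhase]
    rw [← Complex.exp_sum, Finset.mul_sum]
  simp only [overlap, R8, dotProduct_sum, dotProduct_smul, dotProduct_single_one, Pi.star_apply,
    Phi_apply, hphase]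
  refine Finset.sum_congr rfl fun b _ => ?_
  simp [eq_comm]

/-- The permutations that fix a word form a product of symmetric groups. -/
lemma sum_overlap : ∑ π, overlap E t π = ∑ b : Idx D,
    (∏ m, alternatingPhase E t m (b m)) * ∏ a, ((occurrences b a).factorial : ℂ) := by
  simp only [overlap_eq_sum]
  rw [Finset.sum_comm]
  refine Finset.sum_congr rfl fun b _ => ?_
  rw [← Finset.sum_filter, Finset.sum_const, nsmul_eq_mul, mul_comm]
  congr 1
  have h := DomMulAct.stabilizer_card b
  simp only [← Nat.cast_prod, occurrences]
  rw [← h, Fintype.card_subtype]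
  congr 1
  refine Finset.card_bij (fun π _ => π.symm) ?_ ?_ ?_
  · intro π hπ; simpa using hπ
  · intro π _ π' _ h; exact Equiv.symm_bijective.injective h
  · intro π hπ; exact ⟨π.symm, by simpa using hπ, by simp⟩

lemma normSq_sum_pow_four (y : Fin D → ℝ) :
    ((Complex.normSq (∑ a, (y a : ℂ) * star (energyPhase E t a)) ^ 4 : ℝ) : ℂ) =
      ∑ b : Idx D, (∏ m, alternatingPhase E t m (b m)) * ((∏ m, y (b m) : ℝ) : ℂ) := by
  have h := Finset.prod_univ_sum (fun _ : Fin 8 => (Finset.univ : Finset (Fin D)))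
    (fun m a => alternatingPhase E t m a * (y a : ℂ))
  simp only [Finset.prod_mul_distrib, Fintype.piFinset_univ] at h
  push_cast
  rw [← h, ← Complex.mul_conj]
  have h1 : ∀ m : Fin 8, (-1 : ℂ) ^ (m : ℕ) = 1 → ∑ a, alternatingPhase E t m a * (y a : ℂ) =
      (starRingEnd ℂ) (∑ a, (y a : ℂ) * star (energyPhase E t a)) := by
    intro m hm
    simp [alternatingPhase, hm, energyPhase, mul_comm]
  have h2 : ∀ m : Fin 8, (-1 : ℂ) ^ (m : ℕ) = -1 → ∑ a, alternatingPhase E t m a * (y a : ℂ) =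
      ∑ a, (y a : ℂ) * star (energyPhase E t a) := by
    intro m hm
    simp [alternatingPhase, hm, star_energyPhase, mul_comm]
  rw [Fin.prod_univ_eight, h1 0 (by simp), h2 1 (by simp), h1 2 (by simp),
    h2 3 (by norm_num [Fin.val_ofNat]), h1 4 (by norm_num [Fin.val_ofNat]),
    h2 5 (by norm_num [Fin.val_ofNat]), h1 6 (by norm_num [Fin.val_ofNat]),
    h2 7 (by norm_num [Fin.val_ofNat])]
  ring

end PermutationSum

section Vandermonde

/-- The kernel `(m, n) ↦ (m + n)!` as a sum of squares. -/
lemma factorial_add_eq_sum {m N : ℕ} (n : ℕ) (hm : m ≤ N) :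
    (m + n).factorial = ∑ k ∈ Finset.range (N + 1),
      (m.choose k * m.factorial) * (n.choose k * n.factorial) := by
  have h1 : (m + n).choose m = ∑ k ∈ Finset.range (m + 1), m.choose k * n.choose k := by
    rw [Nat.add_choose_eq, Finset.Nat.sum_antidiagonal_eq_sum_range_succ_mk,
      ← Finset.sum_range_reflect]
    refine Finset.sum_congr rfl fun k hk => ?_
    have hk' : k ≤ m := Nat.lt_succ_iff.mp (Finset.mem_range.mp hk)
    rw [Nat.succ_sub_one, Nat.choose_symm hk', Nat.sub_sub_self hk']
  have h2 : ∑ k ∈ Finset.range (N + 1), m.choose k * n.choose k =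
      ∑ k ∈ Finset.range (m + 1), m.choose k * n.choose k := by
    symm
    refine Finset.sum_subset (Finset.range_mono (by omega)) fun k _ hk => ?_
    rw [Nat.choose_eq_zero_of_lt (by simpa using hk), zero_mul]
  rw [← Nat.add_choose_mul_factorial_mul_factorial, Nat.choose_symm_add.symm, h1, ← h2,
    Finset.sum_mul, Finset.sum_mul]
  exact Finset.sum_congr rfl fun k _ => by ring

variable {ι : Type*} [DecidableEq ι] [Fintype ι]

lemma card_words_with_image {n : ℕ} {T : Finset ι} (hT : T.card = n) :
    n.factorial ≤ (Finset.univ.filter fun b : Fin n → ι => Finset.univ.image b = T).card := by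
  have e : Fin n ≃ T := (Finset.equivFinOfCardEq hT).symm
  have : Fintype.card (Fin n ≃ T) = n.factorial := by
    rw [Fintype.card_equiv e, Fintype.card_fin]
  rw [← this, ← Finset.card_univ]
  refine Finset.card_le_card_of_injOn (fun e m => (e m : ι)) (fun e _ => ?_) ?_
  · simp only [Finset.coe_filter, Finset.mem_univ, true_and, Set.mem_ofPred_eq]
    ext a
    simp only [Finset.mem_image, Finset.mem_univ, true_and]
    exact ⟨fun ⟨m, hm⟩ => hm ▸ (e m).2, fun ha => ⟨e.symm ⟨a, ha⟩, by simp⟩⟩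
  · intro e _ e' _ h
    ext m
    exact congrFun h m

/-- A word of length `n` in which the letters of an `n`-element set `T` all occur is an enumeration
of `T`. -/
lemma prod_choose_indicator {n : ℕ} {T : Finset ι} (hT : T.card = n) (b : Fin n → ι) :
    ∏ a, ((occurrences b a).choose (if a ∈ T then 1 else 0) * (occurrences b a).factorial) =
      if Finset.univ.image b = T then 1 else 0 := by
  split_ifs with h
  · have hinj : Function.Injective b := by
      have : (Finset.univ.image b).card = (Finset.univ : Finset (Fin n)).card := by
        rw [h, hT, Finset.card_univ, Fintype.card_fin]
      simpa using Finset.card_image_iff.mp this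
    refine Finset.prod_eq_one fun a _ => ?_
    have hle : occurrences b a ≤ 1 := by
      rw [occurrences, Fintype.card_le_one_iff_subsingleton]
      exact ⟨fun x y => Subtype.ext (hinj (x.2.trans y.2.symm))⟩
    by_cases ha : a ∈ T
    · rw [← h] at ha
      obtain ⟨m, -, hm⟩ := Finset.mem_image.mp ha
      have hpos : 0 < occurrences b a := Fintype.card_pos_iff.mpr ⟨⟨m, hm⟩⟩
      have h1 : occurrences b a = 1 := by omega
      rw [h1]; split_ifs <;> simp
    · rw [if_neg ha]
      interval_cases occurrences b a <;> simp
  · have : ∃ a ∈ T, a ∉ Finset.univ.image b := by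
      by_contra! hcon
      refine h (Finset.eq_of_subset_of_card_le hcon ?_).symm
      rw [hT]
      exact Finset.card_image_le.trans (by simp)
    obtain ⟨a, ha, hb⟩ := this
    refine Finset.prod_eq_zero (Finset.mem_univ a) ?_
    have h0 : occurrences b a = 0 := by
      rw [occurrences, Fintype.card_eq_zero_iff]
      exact ⟨fun x => hb (Finset.mem_image.mpr ⟨x.1, Finset.mem_univ _, x.2⟩)⟩
    simp [h0, ha]

/-- The lower bound for the sum over pairs of words. By the Vandermonde identity the sum is a sum of
squares indexed by the exponents `κ : ι → ℕ`; the bound keeps the indicator functions `κ` of the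
`n`-element sets. -/
lemma factorial_mul_descFactorial_le (u : ι → ℂ) (hu : ∀ a, u a * star (u a) = 1) (n : ℕ) :
    ((n.factorial * (Fintype.card ι).descFactorial n : ℕ) : ℝ) ≤
      (∑ b : Fin n → ι, ∑ c : Fin n → ι, (∏ m, u (b m)) * star (∏ m, u (c m)) *
        ∏ a, ((occurrences b a + occurrences c a).factorial : ℂ)).re := by
  let F : (ι → ℕ) → ℂ := fun κ => ∑ b : Fin n → ι, (∏ m, u (b m)) *
    ((∏ a, ((occurrences b a).choose (κ a) * (occurrences b a).factorial) : ℕ) : ℂ)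
  have hle : ∀ (b : Fin n → ι) a, occurrences b a ≤ n := fun b a => by
    rw [occurrences, Fintype.card_subtype]
    exact (Finset.card_le_univ _).trans (by simp)
  have hsq : ∑ b : Fin n → ι, ∑ c : Fin n → ι, (∏ m, u (b m)) * star (∏ m, u (c m)) *
        ∏ a, ((occurrences b a + occurrences c a).factorial : ℂ) =
      ∑ κ ∈ Fintype.piFinset fun _ : ι => Finset.range (n + 1), F κ * star (F κ) := by
    have hprod : ∀ b c : Fin n → ι, ∏ a, ((occurrences b a + occurrences c a).factorial : ℂ) =
        ∑ κ ∈ Fintype.piFinset fun _ : ι => Finset.range (n + 1),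
          ((∏ a, ((occurrences b a).choose (κ a) * (occurrences b a).factorial) : ℕ) : ℂ) *
          ((∏ a, ((occurrences c a).choose (κ a) * (occurrences c a).factorial) : ℕ) : ℂ) := by
      intro b c
      simp only [← Nat.cast_mul, ← Finset.prod_mul_distrib, ← Nat.cast_sum]
      rw [← Finset.prod_univ_sum (fun _ : ι => Finset.range (n + 1)) (fun a k =>
        (occurrences b a).choose k * (occurrences b a).factorial *
          ((occurrences c a).choose k * (occurrences c a).factorial))]
      push_cast
      refine Finset.prod_congr rfl fun a _ => ?_
      rw [factorial_add_eq_sum _ (hle b a)]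
      push_cast
      rfl
    simp only [hprod, Finset.mul_sum]
    rw [Finset.sum_congr rfl fun b _ => Finset.sum_comm, Finset.sum_comm]
    refine Finset.sum_congr rfl fun κ _ => ?_
    simp only [F, star_sum, Finset.sum_mul_sum]
    refine Finset.sum_congr rfl fun b _ => Finset.sum_congr rfl fun c _ => ?_
    rw [star_mul', star_natCast]
    ring
  have hsq' : ∀ κ, (F κ * star (F κ)).re = Complex.normSq (F κ) := fun κ => by
    rw [Complex.star_def, Complex.mul_conj, Complex.ofReal_re]
  rw [hsq, Complex.re_sum]
  simp only [hsq']
  -- the indicator function of a set of `n` letters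
  let χ : Finset ι → ι → ℕ := fun T a => if a ∈ T then 1 else 0
  have hχ : Function.Injective χ := by
    intro T T' h
    ext a
    have := congrFun h a
    by_cases h1 : a ∈ T <;> by_cases h2 : a ∈ T' <;> simp_all [χ]
  have hF : ∀ T ∈ Finset.powersetCard n (Finset.univ : Finset ι),
      ((n.factorial : ℝ) ^ 2) ≤ Complex.normSq (F (χ T)) := by
    intro T hT
    have hT' := (Finset.mem_powersetCard.mp hT).2
    have hval : F (χ T) =
        (Finset.univ.filter fun b : Fin n → ι => Finset.univ.image b = T).card * ∏ a ∈ T, u a := by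
      simp only [F, χ, prod_choose_indicator hT']
      push_cast
      simp only [mul_ite, mul_one, mul_zero]
      rw [← Finset.sum_filter, ← nsmul_eq_mul, ← Finset.sum_const]
      refine Finset.sum_congr rfl fun b hb => ?_
      have hb' := (Finset.mem_filter.mp hb).2
      rw [← hb', Finset.prod_image]
      have : (Finset.univ.image b).card = (Finset.univ : Finset (Fin n)).card := by
        rw [hb', hT', Finset.card_univ, Fintype.card_fin]
      exact Finset.card_image_iff.mp this
    have hu' : ∀ a, Complex.normSq (u a) = 1 := fun a => by
      have := hu a
      rw [Complex.star_def, Complex.mul_conj] at this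
      exact_mod_cast this
    rw [hval, map_mul, map_prod, Finset.prod_congr rfl fun a _ => hu' a, Finset.prod_const_one,
      mul_one, Complex.normSq_natCast, ← pow_two]
    gcongr
    exact card_words_with_image hT'
  calc ((n.factorial * (Fintype.card ι).descFactorial n : ℕ) : ℝ)
      = ∑ T ∈ Finset.powersetCard n (Finset.univ : Finset ι), (n.factorial : ℝ) ^ 2 := by
        rw [Finset.sum_const, Finset.card_powersetCard, Finset.card_univ,
          Nat.descFactorial_eq_factorial_mul_choose, nsmul_eq_mul]
        push_cast
        ring
    _ ≤ ∑ T ∈ Finset.powersetCard n (Finset.univ : Finset ι), Complex.normSq (F (χ T)) :=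
        Finset.sum_le_sum hF
    _ = ∑ κ ∈ (Finset.powersetCard n Finset.univ).image χ, Complex.normSq (F κ) := by
        rw [Finset.sum_image hχ.injOn]
    _ ≤ _ := by
        refine Finset.sum_le_sum_of_subset_of_nonneg ?_ fun κ _ _ => Complex.normSq_nonneg _
        intro κ hκ
        obtain ⟨T, hT, rfl⟩ := Finset.mem_image.mp hκ
        have hT' := (Finset.mem_powersetCard.mp hT).2
        simp only [Fintype.mem_piFinset, Finset.mem_range, χ]
        intro a
        split_ifs with ha
        · have := Finset.card_pos.mpr ⟨a, ha⟩
          omega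
        · omega

end Vandermonde

/-! ### Bounds for the overlaps -/

section OverlapBounds

/-- Words of length eight as pairs of words of length four, read at the positions with even and
with odd index. -/
def interleave (ι : Type*) : (Fin 4 → ι) × (Fin 4 → ι) ≃ (Fin 8 → ι) where
  toFun p := ![p.1 0, p.2 0, p.1 1, p.2 1, p.1 2, p.2 2, p.1 3, p.2 3]
  invFun b := (![b 0, b 2, b 4, b 6], ![b 1, b 3, b 5, b 7])
  left_inv p := by
    refine Prod.ext ?_ ?_ <;> funext m <;> fin_cases m <;> rfl
  right_inv b := by
    funext m; fin_cases m <;> rfl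

variable {D : ℕ} (E : Fin D → ℝ) (t : ℝ)

lemma occurrences_interleave (p : (Fin 4 → Fin D) × (Fin 4 → Fin D)) (a : Fin D) :
    occurrences (interleave _ p) a = occurrences p.1 a + occurrences p.2 a := by
  simp only [occurrences, Fintype.card_subtype, Finset.card_filter, Fin.sum_univ_eight,
    Fin.sum_univ_four]
  simp only [interleave, Equiv.coe_fn_mk]
  change (if p.1 0 = a then 1 else 0) + (if p.2 0 = a then 1 else 0) +
    (if p.1 1 = a then 1 else 0) + (if p.2 1 = a then 1 else 0) +
    (if p.1 2 = a then 1 else 0) + (if p.2 2 = a then 1 else 0) +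
    (if p.1 3 = a then 1 else 0) + (if p.2 3 = a then 1 else 0) = _
  ring

lemma alternatingPhase_even {m : Fin 8} (hm : (-1 : ℂ) ^ (m : ℕ) = 1) (a : Fin D) :
    alternatingPhase E t m a = energyPhase E t a := by
  simp [alternatingPhase, hm, energyPhase]

lemma alternatingPhase_odd {m : Fin 8} (hm : (-1 : ℂ) ^ (m : ℕ) = -1) (a : Fin D) :
    alternatingPhase E t m a = star (energyPhase E t a) := by
  simp [alternatingPhase, hm, star_energyPhase]

lemma prod_alternatingPhase (b : Idx D) :
    ∏ m, alternatingPhase E t m (b m) =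
      (energyPhase E t (b 0) * energyPhase E t (b 2) * energyPhase E t (b 4) *
        energyPhase E t (b 6)) *
      star (energyPhase E t (b 1) * energyPhase E t (b 3) * energyPhase E t (b 5) *
        energyPhase E t (b 7)) := by
  rw [Fin.prod_univ_eight, alternatingPhase_even E t (by simp), alternatingPhase_odd E t (by simp),
    alternatingPhase_even E t (by simp), alternatingPhase_odd E t (by norm_num [Fin.val_ofNat]),
    alternatingPhase_even E t (by norm_num [Fin.val_ofNat]),
    alternatingPhase_odd E t (by norm_num [Fin.val_ofNat]),
    alternatingPhase_even E t (by norm_num [Fin.val_ofNat]),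
    alternatingPhase_odd E t (by norm_num [Fin.val_ofNat])]
  simp only [star_mul']
  ring

/-- The leading term `24 D ^ 4` is the contribution of the involutions that pair the positions of even
index with those of odd index: there are `4!` of them, and each has overlap `D ^ 4`. -/
lemma le_re_sum_overlap :
    24 * (D : ℝ) ^ 4 - 144 * (D : ℝ) ^ 3 ≤ (∑ π, overlap E t π).re := by
  have h := factorial_mul_descFactorial_le (energyPhase E t) (energyPhase_mul_star E t) 4
  have hsum : ∑ π, overlap E t π = ∑ b : Fin 4 → Fin D, ∑ c : Fin 4 → Fin D,
      (∏ m, energyPhase E t (b m)) * star (∏ m, energyPhase E t (c m)) *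
        ∏ a, ((occurrences b a + occurrences c a).factorial : ℂ) := by
    rw [sum_overlap, ← Fintype.sum_prod_type', ← (interleave (Fin D)).sum_comp]
    refine Finset.sum_congr rfl fun p _ => ?_
    simp only [occurrences_interleave, prod_alternatingPhase, Fin.prod_univ_four]
    rfl
  rw [hsum]
  refine le_trans ?_ h
  rw [Fintype.card_fin]
  rcases lt_or_ge D 3 with hD | hD
  · interval_cases D <;> norm_num
  · obtain ⟨n, rfl⟩ := Nat.exists_eq_add_of_le' hD
    have h3 : (n + 3).descFactorial 4 = n * ((n + 1) * ((n + 2) * (n + 3))) := by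
      simp [Nat.descFactorial_succ]
    rw [h3]
    simp only [Nat.factorial]
    push_cast
    have hn : (0 : ℝ) ≤ n := n.cast_nonneg
    nlinarith [hn, mul_nonneg hn hn]

/-- The permutation that exchanges each position of even index with its successor. -/
def pairing : Equiv.Perm (Fin 8) :=
  Equiv.swap 0 1 * Equiv.swap 2 3 * Equiv.swap 4 5 * Equiv.swap 6 7

/-- The phases cancel on the words fixed by `pairing`, so that its overlap counts these words. -/
lemma overlap_pairing : ∃ N : ℕ, D ^ 4 ≤ N ∧ overlap E t pairing = N := by
  have hval : ∀ m, pairing.symm m = (![1, 0, 3, 2, 5, 4, 7, 6] : Fin 8 → Fin 8) m := by decide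
  refine ⟨(Finset.univ.filter fun b : Idx D => b ∘ pairing.symm = b).card, ?_, ?_⟩
  · have hc : D ^ 4 = Fintype.card (Fin 4 → Fin D) := by simp
    rw [hc, ← Finset.card_univ]
    refine Finset.card_le_card_of_injOn (fun c => interleave _ (c, c)) (fun c _ => ?_) ?_
    · simp only [Finset.coe_filter, Finset.mem_univ, true_and, Set.mem_ofPred_eq]
      funext m
      simp only [Function.comp, hval]
      fin_cases m <;> rfl
    · intro c _ c' _ h
      exact congrArg Prod.fst ((interleave _).injective h)
  · rw [overlap_eq_sum, ← Finset.sum_filter, Finset.card_eq_sum_ones, Nat.cast_sum]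
    refine Finset.sum_congr rfl fun b hb => ?_
    have hb' : ∀ m, b (pairing.symm m) = b m := congrFun (Finset.mem_filter.mp hb).2
    have h0 : b 1 = b 0 := by simpa [hval] using hb' 0
    have h2 : b 3 = b 2 := by simpa [hval] using hb' 2
    have h4 : b 5 = b 4 := by simpa [hval] using hb' 4
    have h6 : b 7 = b 6 := by simpa [hval] using hb' 6
    rw [prod_alternatingPhase, h0, h2, h4, h6, star_mul', star_mul', star_mul']
    have hu := energyPhase_mul_star E t
    rw [Nat.cast_one]
    calc _ = (energyPhase E t (b 0) * star (energyPhase E t (b 0))) *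
          (energyPhase E t (b 2) * star (energyPhase E t (b 2))) *
          (energyPhase E t (b 4) * star (energyPhase E t (b 4))) *
          (energyPhase E t (b 6) * star (energyPhase E t (b 6))) := by ring
      _ = 1 := by simp only [hu, mul_one]

end OverlapBounds

/-! ### Haar distributed unitaries and the evolution operator -/

section Haar

variable (D : ℕ)

instance isHaarMeasure_haarU : (haarU D).IsHaarMeasure := by
  unfold haarU; infer_instance

instance isProbabilityMeasure_haarU : IsProbabilityMeasure (haarU D) := by
  constructor
  have := Measure.haarMeasure_self (K₀ := (⊤ : TopologicalSpace.PositiveCompacts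
    (Matrix.unitaryGroup (Fin D) ℂ)))
  simpa [haarU] using this

/-- The group `U(D)` is compact, hence unimodular. -/
lemma map_mul_right_haarU (R : Matrix.unitaryGroup (Fin D) ℂ) :
    (haarU D).map (· * R) = haarU D := by
  have : IsProbabilityMeasure ((haarU D).map (· * R)) :=
    Measure.isProbabilityMeasure_map (continuous_mul_const R).measurable.aemeasurable
  exact Measure.isHaarMeasure_eq_of_isProbabilityMeasure _ _

variable {D}

lemma integral_mul_left_haarU (R : Matrix.unitaryGroup (Fin D) ℂ) {F : Type*}
    [NormedAddCommGroup F] [NormedSpace ℝ F] (f : Matrix.unitaryGroup (Fin D) ℂ → F) :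
    ∫ C, f (R * C) ∂haarU D = ∫ C, f C ∂haarU D :=
  integral_mul_left_eq_self f R

/-- The closed form `C diag(exp (-i t E₁), …, exp (-i t E_D)) C†` of the evolution operator. -/
noncomputable def conjugatedPhases (E : Fin D → ℝ) (t : ℝ) (C : Matrix.unitaryGroup (Fin D) ℂ) :
    Matrix (Fin D) (Fin D) ℂ :=
  (C : Matrix (Fin D) (Fin D) ℂ) * Matrix.diagonal (fun a => star (energyPhase E t a)) *
    (C : Matrix (Fin D) (Fin D) ℂ)ᴴ

lemma evolution_hamiltonian (E : Fin D → ℝ) (t : ℝ) (C : Matrix.unitaryGroup (Fin D) ℂ) :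
    evolution (hamiltonian E C) t = conjugatedPhases E t C := by
  have hinv : ((C : Matrix (Fin D) (Fin D) ℂ))⁻¹ = (C : Matrix (Fin D) (Fin D) ℂ)ᴴ :=
    Matrix.inv_eq_right_inv (Matrix.mem_unitaryGroup_iff.mp C.2)
  have hunit : IsUnit (C : Matrix (Fin D) (Fin D) ℂ) :=
    IsUnit.of_mul_eq_one _ (Matrix.mem_unitaryGroup_iff.mp C.2)
  rw [evolution, hamiltonian, ← hinv, ← smul_mul_assoc, ← mul_smul_comm, Matrix.exp_conj _ _ hunit,
    conjugatedPhases, hinv, ← Matrix.diagonal_smul, Matrix.exp_diagonal]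
  congr 3
  funext a
  rw [Pi.coe_exp, star_energyPhase, ← Complex.exp_eq_exp_ℂ]
  simp [mul_assoc]

lemma outcomeProb_eq_normSq (k x : EuclideanSpace ℂ (Fin D)) (H : Matrix (Fin D) (Fin D) ℂ)
    (t : ℝ) : outcomeProb k x H t =
      Complex.normSq ((star (fun i => k i) ᵥ* evolution H t) ⬝ᵥ fun i => x i) := by
  rw [outcomeProb]
  generalize evolution H t = U
  have h : (Matrix.trace (ketbra k * U * ketbra x * Uᴴ)) =
      ((star (fun i => k i) ᵥ* U) ⬝ᵥ fun i => x i) *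
        star ((star (fun i => k i) ᵥ* U) ⬝ᵥ fun i => x i) := by
    have hk : ∀ v : EuclideanSpace ℂ (Fin D),
        ketbra v = Matrix.vecMulVec (fun i => v i) (star fun i => v i) := fun v => rfl
    rw [hk, hk, Matrix.vecMulVec_mul, Matrix.vecMulVec_mul_vecMulVec, Matrix.vecMulVec_mul,
      Matrix.smul_vecMul, Matrix.trace_vecMulVec, dotProduct_smul, smul_eq_mul,
      ← Matrix.star_mulVec, ← Matrix.dotProduct_mulVec, ← Matrix.star_dotProduct_star, star_star,
      dotProduct_comm (fun i => k i) (star _)]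
  rw [h, Complex.star_def, Complex.mul_conj, Complex.ofReal_re]

lemma outcomeProb_eigenvectorBasis {A : Matrix (Fin D) (Fin D) ℂ} (hA : A.IsHermitian)
    (k x : Fin D) (E : Fin D → ℝ) (t : ℝ) (C : Matrix.unitaryGroup (Fin D) ℂ) :
    outcomeProb (hA.eigenvectorBasis k) (hA.eigenvectorBasis x) (hamiltonian E C) t =
      Complex.normSq (conjugatedPhases E t (star hA.eigenvectorUnitary * C) k x) := by
  rw [outcomeProb_eq_normSq, evolution_hamiltonian]
  congr 1
  set V := hA.eigenvectorUnitary with hV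
  have hV' : ∀ i j, (V : Matrix (Fin D) (Fin D) ℂ) i j = hA.eigenvectorBasis j i := fun i j =>
    hA.eigenvectorUnitary_apply i j
  have h : conjugatedPhases E t (star V * C) =
      (V : Matrix (Fin D) (Fin D) ℂ)ᴴ * conjugatedPhases E t C *
        (V : Matrix (Fin D) (Fin D) ℂ) := by
    simp [conjugatedPhases, Matrix.star_eq_conjTranspose, Matrix.mul_assoc]
  rw [h, Matrix.mul_apply]
  simp only [dotProduct, Matrix.mul_apply, Matrix.vecMul, hV', Matrix.conjTranspose_apply,
    Pi.star_apply]

/-- By invariance of the Haar measure the eigenbasis of `A` may be taken to be the standard basis. -/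
lemma integral_outcomeProb {A : Matrix (Fin D) (Fin D) ℂ} (hA : A.IsHermitian)
    (k x : Fin D) (E : Fin D → ℝ) (t : ℝ) :
    ∫ C, outcomeProb (hA.eigenvectorBasis k) (hA.eigenvectorBasis x) (hamiltonian E C) t ^ 4
      ∂haarU D = ∫ C, Complex.normSq (conjugatedPhases E t C k x) ^ 4 ∂haarU D := by
  simp only [outcomeProb_eigenvectorBasis]
  exact integral_mul_left_haarU _ fun C => Complex.normSq (conjugatedPhases E t C k x) ^ 4

lemma continuous_coe_unitaryGroup :
    Continuous fun C : Matrix.unitaryGroup (Fin D) ℂ => (C : Matrix (Fin D) (Fin D) ℂ) :=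
  continuous_subtype_val

/-- A row of a Haar distributed unitary matrix is a uniformly distributed unit vector. -/
lemma unitarilyInvariantOn_row (k : Fin D) :
    UnitarilyInvariantOn (haarU D)
      (fun C : Matrix.unitaryGroup (Fin D) ℂ => (C : Matrix (Fin D) (Fin D) ℂ) k)
      Finset.univ := by
  intro R hR _ g hg
  have hgc : Continuous fun C : Matrix.unitaryGroup (Fin D) ℂ =>
      g ((C : Matrix (Fin D) (Fin D) ℂ) k) :=
    hg.comp ((continuous_apply k).comp continuous_coe_unitaryGroup)
  conv_rhs => rw [← map_mul_right_haarU D ⟨R, hR⟩]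
  rw [integral_map (continuous_mul_const _).measurable.aemeasurable hgc.aestronglyMeasurable]
  rfl

lemma sum_normSq_row {U : Matrix (Fin D) (Fin D) ℂ} (hU : U ∈ Matrix.unitaryGroup (Fin D) ℂ)
    (k : Fin D) : ∑ a, Complex.normSq (U k a) = 1 := by
  have h := congrFun (congrFun (Matrix.mem_unitaryGroup_iff.mp hU) k) k
  rw [Matrix.mul_apply, Matrix.one_apply_eq] at h
  simp only [Matrix.star_apply, Complex.star_def, Complex.mul_conj] at h
  exact_mod_cast h

lemma conjugatedPhases_mem (E : Fin D → ℝ) (t : ℝ) (C : Matrix.unitaryGroup (Fin D) ℂ) :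
    conjugatedPhases E t C ∈ Matrix.unitaryGroup (Fin D) ℂ := by
  have hd : Matrix.diagonal (fun a => star (energyPhase E t a)) ∈
      Matrix.unitaryGroup (Fin D) ℂ := by
    rw [Matrix.mem_unitaryGroup_iff, Matrix.star_eq_conjTranspose, Matrix.diagonal_conjTranspose,
      Matrix.diagonal_mul_diagonal, ← Matrix.diagonal_one]
    congr 1
    funext a
    have := energyPhase_mul_star E t a
    rw [mul_comm] at this
    simpa using this
  exact mul_mem (mul_mem C.2 hd) (star C).2

lemma continuous_conjugatedPhases (E : Fin D → ℝ) (t : ℝ) :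
    Continuous (conjugatedPhases E t) := by
  have := continuous_coe_unitaryGroup (D := D)
  unfold conjugatedPhases
  fun_prop

/-- The part off the diagonal of the row `k` of the evolution operator is invariant under the
unitaries that fix the `k`-th basis vector: they act by conjugation. -/
lemma unitarilyInvariantOn_evolution_row (E : Fin D → ℝ) (t : ℝ) (k : Fin D) :
    UnitarilyInvariantOn (haarU D) (fun C => conjugatedPhases E t C k) (Finset.univ.erase k) := by
  intro R hR hfix g hg
  have hk : ∀ j, R j k = (1 : Matrix (Fin D) (Fin D) ℂ) j k := fun j => (hfix k (by simp) j).2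
  rw [← integral_mul_left_haarU (star ⟨R, hR⟩) fun C => g (conjugatedPhases E t C k)]
  refine integral_congr_ae (.of_forall fun C => ?_)
  simp only
  congr 1
  have h : conjugatedPhases E t (star ⟨R, hR⟩ * C) = Rᴴ * (conjugatedPhases E t C * R) := by
    simp [conjugatedPhases, Matrix.star_eq_conjTranspose, Matrix.mul_assoc]
  funext x
  rw [h, Matrix.mul_apply]
  simp only [Matrix.conjTranspose_apply, hk, Matrix.one_apply]
  simp [Matrix.mul_apply, Matrix.vecMul, dotProduct]

/-- For `k = x` the amplitude is `∑ₐ |C k a|² exp (-i t E_a)`, so that the moments of a uniformly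
distributed unit vector turn the integral into a multiple of the sum of all overlaps. -/
lemma ascFactorial_mul_integral_diag (E : Fin D → ℝ) (t : ℝ) (k : Fin D) :
    (((D.ascFactorial 8 : ℝ) * ∫ C, Complex.normSq (conjugatedPhases E t C k k) ^ 4 ∂haarU D : ℝ) :
      ℂ) = ∑ π, overlap E t π := by
  have hrow : ∀ C : Matrix.unitaryGroup (Fin D) ℂ, conjugatedPhases E t C k k =
      ∑ a, (Complex.normSq ((C : Matrix (Fin D) (Fin D) ℂ) k a) : ℂ) *
        star (energyPhase E t a) := by
    intro C
    rw [conjugatedPhases, Matrix.mul_apply]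
    simp only [Matrix.mul_diagonal, Matrix.conjTranspose_apply, ← Complex.mul_conj,
      Complex.star_def]
    exact Finset.sum_congr rfl fun a _ => by ring
  have hc : ∀ a, Continuous fun C : Matrix.unitaryGroup (Fin D) ℂ =>
      Complex.normSq ((C : Matrix (Fin D) (Fin D) ℂ) k a) := fun a =>
    Complex.continuous_normSq.comp ((continuous_apply a).comp
      ((continuous_apply k).comp continuous_coe_unitaryGroup))
  have hmom : ∀ b : Idx D, ((D.ascFactorial 8 : ℝ) : ℂ) *
      ((∫ C : Matrix.unitaryGroup (Fin D) ℂ,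
        ∏ m, Complex.normSq ((C : Matrix (Fin D) (Fin D) ℂ) k (b m)) ∂haarU D : ℝ) : ℂ) =
      ∏ a, ((occurrences b a).factorial : ℂ) := by
    intro b
    have h := (unitarilyInvariantOn_row k).integral_prod_normSq
      ((continuous_apply k).comp continuous_coe_unitaryGroup) (fun C => sum_normSq_row C.2 k) b
    rw [Fintype.card_fin] at h
    exact_mod_cast h
  rw [sum_overlap, Complex.ofReal_mul, ← integral_complex_ofReal]
  simp only [hrow, normSq_sum_pow_four]
  rw [integral_finsetSum _ fun b _ => integrable_of_continuous (by fun_prop), Finset.mul_sum]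
  refine Finset.sum_congr rfl fun b _ => ?_
  rw [integral_const_mul, integral_complex_ofReal, ← hmom b]
  ring

/-- For `k ≠ x` the integral is at most `4! / ((D - 1) D (D + 1) (D + 2))`, by the moment bound for
a unitarily invariant vector in dimension `D - 1`; for `D ≥ 2` this is at most `24 / D ^ 4`. -/
lemma integral_offDiag_le (E : Fin D → ℝ) (t : ℝ) {k x : Fin D} (hkx : k ≠ x) :
    (D : ℝ) ^ 4 * ∫ C, Complex.normSq (conjugatedPhases E t C k x) ^ 4 ∂haarU D ≤ 24 := by
  have hI : 0 ≤ ∫ C, Complex.normSq (conjugatedPhases E t C k x) ^ 4 ∂haarU D :=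
    integral_nonneg fun C => pow_nonneg (Complex.normSq_nonneg _) _
  have h := (unitarilyInvariantOn_evolution_row E t k).integral_normSq_pow_le
    ((continuous_apply k).comp (continuous_conjugatedPhases E t))
    (fun C => by
      rw [← sum_normSq_row (conjugatedPhases_mem E t C) k]
      exact Finset.sum_le_sum_of_subset_of_nonneg (Finset.erase_subset _ _)
        fun a _ _ => Complex.normSq_nonneg _)
    (Finset.mem_erase.mpr ⟨hkx.symm, Finset.mem_univ x⟩) 4
  rw [Finset.card_erase_of_mem (Finset.mem_univ k), Finset.card_univ, Fintype.card_fin] at h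
  have hD : 2 ≤ D := by
    have hk := k.2
    have hx := x.2
    have : (k : ℕ) ≠ x := fun h => hkx (Fin.ext h)
    omega
  obtain ⟨n, rfl⟩ := Nat.exists_eq_add_of_le' hD
  have hle : ((n + 2 : ℕ) : ℝ) ^ 4 ≤ ((n + 2 - 1).ascFactorial 4 : ℕ) := by
    have : (n + 2 - 1).ascFactorial 4 = (n + 4) * ((n + 3) * ((n + 2) * (n + 1))) := by
      simp [Nat.ascFactorial_succ]
    rw [this]
    push_cast
    have hn : (0 : ℝ) ≤ n := n.cast_nonneg
    nlinarith [mul_nonneg hn hn, mul_nonneg hn (mul_nonneg hn hn)]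
  calc _ ≤ _ := mul_le_mul_of_nonneg_right hle hI
    _ ≤ _ := h
    _ = 24 := by norm_num [Nat.factorial]

end Haar

end FourthMoment

theorem lemma4 :
    ∃ (K : ℝ) (B : ℕ → Matrix (Equiv.Perm (Fin 8)) (Equiv.Perm (Fin 8)) ℝ),
      (∀ (D : ℕ), 1 ≤ D → ∀ π σ : Equiv.Perm (Fin 8), |B D π σ| ≤ K / (D : ℝ) ^ 9) ∧
      ∀ (D : ℕ) (A : Matrix (Fin D) (Fin D) ℂ) (hA : A.IsHermitian),
        Function.Injective hA.eigenvalues →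
        ∀ (x k : Fin D) (E : Fin D → ℝ) (t : ℝ),
          let rhs : ℂ :=
            1 / (D : ℂ) ^ 8 * ∑ π : Equiv.Perm (Fin 8), FourthMoment.overlap E t π +
              ∑ π : Equiv.Perm (Fin 8), ∑ σ : Equiv.Perm (Fin 8),
                (B D π σ : ℂ) * FourthMoment.overlap E t σ
          rhs.im = 0 ∧
          ∫ C : Matrix.unitaryGroup (Fin D) ℂ,
              FourthMoment.outcomeProb (hA.eigenvectorBasis k) (hA.eigenvectorBasis x)
                (FourthMoment.hamiltonian E C) t ^ 4 ∂(FourthMoment.haarU D) ≤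
            rhs.re := by
  -- The correction lives on one permutation: `(144 / D ^ 9) * D ^ 4` makes up for the term
  -- `-144 * D ^ 3` in the lower bound for the sum of the overlaps.
  refine ⟨144, fun D => Matrix.single 1 FourthMoment.pairing (144 / (D : ℝ) ^ 9), ?_, ?_⟩
  · intro D _ π σ
    have hnn : (0 : ℝ) ≤ 144 / (D : ℝ) ^ 9 := by positivity
    simp only [Matrix.single_apply]
    split_ifs
    · rw [abs_of_nonneg hnn]
    · rwa [abs_zero]
  intro D A hA _ x k E t rhs
  have hD : (0 : ℝ) < D := by exact_mod_cast (Nat.zero_le _).trans_lt x.2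
  obtain ⟨N, hN, hpair⟩ := FourthMoment.overlap_pairing E t
  set I := ∫ C, Complex.normSq (FourthMoment.conjugatedPhases E t C k k) ^ 4
    ∂FourthMoment.haarU D with hI
  have hI0 : 0 ≤ I := MeasureTheory.integral_nonneg fun C => pow_nonneg (Complex.normSq_nonneg _) _
  have hdiag := FourthMoment.ascFactorial_mul_integral_diag E t k
  rw [← hI] at hdiag
  have hrhs : rhs =
      ((1 / (D : ℝ) ^ 8 * (D.ascFactorial 8 * I) + 144 / (D : ℝ) ^ 9 * N : ℝ) : ℂ) := by
    simp only [rhs, ← hdiag]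
    rw [Finset.sum_eq_single 1 (fun π _ hπ => by simp [hπ.symm])
      (by simp), Finset.sum_eq_single FourthMoment.pairing
      (fun σ _ hσ => by simp [hσ.symm]) (by simp), hpair]
    simp
  have hN' : (D : ℝ) ^ 4 ≤ N := by exact_mod_cast hN
  rw [hrhs]
  refine ⟨Complex.ofReal_im _, ?_⟩
  rw [Complex.ofReal_re, FourthMoment.integral_outcomeProb]
  rcases eq_or_ne k x with rfl | hkx
  · have hasc : (D : ℝ) ^ 8 ≤ D.ascFactorial 8 := by
      exact_mod_cast Nat.pow_succ_le_ascFactorial D 8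
    rw [← hI]
    have h1 : I ≤ 1 / (D : ℝ) ^ 8 * (D.ascFactorial 8 * I) := by
      rw [← mul_assoc, one_div_mul_eq_div]
      exact le_mul_of_one_le_left hI0 ((one_le_div (by positivity)).mpr hasc)
    have h2 : 0 ≤ 144 / (D : ℝ) ^ 9 * N := by positivity
    linarith
  · have hoff := FourthMoment.integral_offDiag_le E t hkx
    have hlow := FourthMoment.le_re_sum_overlap E t
    rw [← hdiag, Complex.ofReal_re] at hlow
    set J := ∫ C, Complex.normSq (FourthMoment.conjugatedPhases E t C k x) ^ 4
      ∂FourthMoment.haarU D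
    have h1 : J ≤ 24 / (D : ℝ) ^ 4 := by
      rw [le_div_iff₀ (by positivity)]; linarith
    calc J ≤ 24 / (D : ℝ) ^ 4 := h1
      _ = 1 / (D : ℝ) ^ 8 * (24 * D ^ 4 - 144 * D ^ 3) + 144 / (D : ℝ) ^ 9 * D ^ 4 := by
        field_simp; ring
      _ ≤ _ := by gcongr
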